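/- **Model.** A system has $n$ nodes, among them $2m+1$ proposers and $3f+1$ voters (a node may play both roles); at most $m$ proposers and at most $f$ voters are Byzantine, and all Byzantine nodes, as well as the network, are controlled by one adversary. Let $\beta$ be the fraction of the proposers that is Byzantine. There are a delay bound $\Delta>0$ and a time $\mathsf{GST}\ge 0$ such that every message (block or vote) that an honest node has seen by time $s$ has been seen by all honest nodes by time $\max(s,\mathsf{GST})+\Delta$. Honest nodes' signatures cannot be forged. The proposers find block proofs at the times of independent Poisson processes of rate $\lambda/(2m+1)$ each, so that the total rate is $\lambda>0$, and each block proof yields (at most) one block. *Protocol LBFT.* Every block except the genesis block contains its parent, a quorum certificate of the parent (valid votes by at least $2f+1$ voters; none is needed for the genesis block), transactions that are consistent with those of its ancestors, and a block proof. The height of a block is its distance from the genesis block; two distinct blocks conflict if neither is a descendant of the other. A block is certified for a node that has seen it together with valid votes for it by at least $2f+1$ voters; the genesis block is certified. - *Proposing:* an honest proposer that finds a block proof immediately produces and broadcasts a block on top of a highest certified block that it has seen. - *Voting:* an honest voter votes for a new valid block if and only if that block extends a highest certified block that the voter has seen. It sends a witness vote if it has voted before for a block that conflicts with the parent of the new block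 and is no lower than this parent, and a commit vote otherwise. A witness vote is valid only if it comes with such a conflicting (valid) block as evidence. - *Committing:* a node commits all ancestors of every certified block for which it has seen commit votes by at least $2f+1$ voters. The committed blocks form its main chain. **Theorem (Liveness).** Let $\lambda,\Delta,\delta>0$, $\beta\ge 0$, $\eta=e^{-2(1-\beta)\lambda\Delta}$, and suppose that $\eta^2(1-\beta)>(1+\delta)\beta$. Then there are constants $c>0$ and $T$, depending only on $\lambda,\Delta,\beta,\delta$, such that for every system as above in which the fraction of Byzantine proposers is $\beta$, every adversary, every $\mathsf{GST}\ge 0$, every $t_0\ge\mathsf{GST}$ and every $t\ge T$, except with probability at most $e^{-ct}$ the following holds: some block produced by an honest proposer during the interval $(t_0,t_0+t]$ is in the main chain of every honest node (that is, has been committed by every honest node) by time $t_0+t$. -/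

import Mathlib

open MeasureTheory ProbabilityTheory
open scoped NNReal ENNReal

namespace LBFT

/-! ### Blocks, votes and messages -/

/-- The type of a vote: a commit vote, or a witness vote, which carries a conflicting block as
evidence. -/
inductive Ballot (α : Type) where
  | comVote : Ballot α
  | witVote (evidence : α) : Ballot α

/-- Blocks over a set of `n` nodes and a type `Tx` of transactions. A block other than the
hard-coded genesis block contains the certificate of its parent (the parent, and the list of
signed votes for it, as pairs of a voter and a ballot), a list of transactions, and a block proof.
The block proof identifies the lottery win by which the block was produced: the winning proposer
and the time of the win. -/
inductive Block (n : ℕ) (Tx : Type) where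
  | genesis : Block n Tx
  | mk (parent : Block n Tx) (qc : List (Fin n × Ballot (Block n Tx))) (txs : List Tx)
      (proof : Fin n × ℝ) : Block n Tx

namespace Block

variable {n : ℕ} {Tx : Type}

/-- The parent of a block (by convention, the genesis block is its own parent). -/
def parent : Block n Tx → Block n Tx
  | genesis => genesis
  | mk p _ _ _ => p

/-- The distance of a block from the genesis block. -/
def height : Block n Tx → ℕ
  | genesis => 0
  | mk p _ _ _ => p.height + 1

/-- All transactions on the chain that ends with a block. -/
def ledger : Block n Tx → List Tx
  | genesis => []
  | mk p _ txs _ => p.ledger ++ txs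

/-- `a.IsAncestor b`: `a` is a proper ancestor of `b` (`b` is a descendant of `a`). -/
def IsAncestor (a : Block n Tx) : Block n Tx → Prop
  | genesis => False
  | mk p _ _ _ => a = p ∨ IsAncestor a p

/-- Two distinct blocks conflict if neither is a descendant of the other. -/
def Conflicts (a b : Block n Tx) : Prop :=
  a ≠ b ∧ ¬ a.IsAncestor b ∧ ¬ b.IsAncestor a

end Block

/-- The messages that nodes exchange: blocks, and signed votes for blocks. -/
inductive Msg (n : ℕ) (Tx : Type) where
  | block (B : Block n Tx) : Msg n Tx
  | vote (voter : Fin n) (B : Block n Tx) (k : Ballot (Block n Tx)) : Msg n Tx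

/-! ### The system -/

/-- A system of `n` nodes with `2m + 1` proposers and `3f + 1` voters (a node may play both roles),
of which at most `m`, respectively `f`, are Byzantine, together with the application-specific
relation saying which lists of new transactions are consistent with the transactions in the
ancestor blocks. -/
structure System (n m f : ℕ) (Tx : Type) where
  proposers : Finset (Fin n)
  voters : Finset (Fin n)
  byz : Finset (Fin n)
  card_proposers : proposers.card = 2 * m + 1
  card_voters : voters.card = 3 * f + 1
  card_byz_proposers : (byz ∩ proposers).card ≤ m
  card_byz_voters : (byz ∩ voters).card ≤ f
  consistent : List Tx → List Tx → Prop

namespace System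

variable {n m f : ℕ} {Tx : Type} (S : System n m f Tx)

/-! ### Local rules

A list of messages stands for the messages that a node has processed so far, in the order in which
it has processed them. -/

/-- A block is certified, for a node that has processed the messages `l`, if the node has the block
and votes (of either type) for it by at least `2f + 1` voters. The genesis block counts as
certified. -/
def Certified (_S : System n m f Tx) (l : List (Msg n Tx)) (C : Block n Tx) : Prop :=
  C = Block.genesis ∨
    (Msg.block C ∈ l ∧ 2 * f + 1 ≤ {v : Fin n | ∃ k, Msg.vote v C k ∈ l}.ncard)

/-- The block `B` extends a highest certified block seen in `l`. -/
def ExtendsHighest (l : List (Msg n Tx)) (B : Block n Tx) : Prop :=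
  S.Certified l B.parent ∧ ∀ C, S.Certified l C → C.height ≤ B.parent.height

/-- Validity check of a message by a node that has processed the messages `l`.
* A block is valid if it is not the genesis block, the node has its parent (unless that is the
  genesis block), the votes in its certificate are valid and come from at least `2f + 1` voters
  (the genesis block needs no certificate), and its transactions are consistent with its ancestors.
  (Validity of the block proof is part of the definition of an execution.)
* A vote is valid if it is a vote by a voter for a block that the node has; the evidence of a
  witness vote must be a block that the node has, that conflicts with the parent of the block voted
  for, and whose height is no lower than that of this parent. -/
def Valid (l : List (Msg n Tx)) : Msg n Tx → Prop
  | Msg.block Block.genesis => False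
  | Msg.block (Block.mk P qc txs _) =>
      (∀ x ∈ qc, Msg.vote x.1 P x.2 ∈ l) ∧
      (P = Block.genesis ∨
        (Msg.block P ∈ l ∧ 2 * f + 1 ≤ {v : Fin n | ∃ k, (v, k) ∈ qc}.ncard)) ∧
      S.consistent P.ledger txs
  | Msg.vote v B Ballot.comVote => v ∈ S.voters ∧ Msg.block B ∈ l
  | Msg.vote v B (Ballot.witVote W) =>
      v ∈ S.voters ∧ Msg.block B ∈ l ∧ Msg.block W ∈ l ∧
      W.Conflicts B.parent ∧ B.parent.height ≤ W.height

/-- `W` is a reason for the voter `v` to send a witness vote for `B`: the voter has voted for `W`,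
which conflicts with the parent of `B` and is no lower than this parent. -/
def WitnessFor (_S : System n m f Tx) (v : Fin n) (l : List (Msg n Tx)) (B W : Block n Tx) : Prop :=
  Msg.block W ∈ l ∧ (∃ k, Msg.vote v W k ∈ l) ∧ W.Conflicts B.parent ∧
    B.parent.height ≤ W.height

/-- The type of the vote that an honest voter `v` sends for `B`. -/
def BallotRule (v : Fin n) (l : List (Msg n Tx)) (B : Block n Tx) :
    Ballot (Block n Tx) → Prop
  | Ballot.comVote => ¬ ∃ W, S.WitnessFor v l B W
  | Ballot.witVote W => S.WitnessFor v l B W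

/-- The main chain of a node that has processed the messages `l`, that is, the blocks that it has
committed: the ancestors of the certified blocks that have commit votes by at least `2f + 1`
voters. -/
def mainChain (l : List (Msg n Tx)) : Set (Block n Tx) :=
  {B | ∃ C, B.IsAncestor C ∧ S.Certified l C ∧
    2 * f + 1 ≤ {v : Fin n | Msg.vote v C Ballot.comVote ∈ l}.ncard}

end System

/-! ### Executions -/

/-- An execution of the protocol, against an adversary that controls the Byzantine nodes and the
network, with delay bound `Δ` and global stabilization time `gst`. Here `wins p` is the set of
times at which the proposer `p` finds a block proof, `mined p τ` is the block produced with the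
block proof found by `p` at time `τ`, and `log h s` is the list of all messages that the node `h`
has processed by time `s` (inclusive), in the order of processing. Only the behaviour of honest
nodes is constrained; Byzantine proposers choose their blocks, and Byzantine voters their votes,
arbitrarily. -/
structure IsExecution {n m f : ℕ} {Tx : Type} (S : System n m f Tx) (Δ gst : ℝ)
    (wins : Fin n → Set ℝ) (mined : Fin n → ℝ → Block n Tx)
    (log : Fin n → ℝ → List (Msg n Tx)) : Prop where
  /-- Logs only grow. -/
  log_mono : ∀ h ∉ S.byz, ∀ s s' : ℝ, s ≤ s' → log h s <+: log h s'
  /-- No message is processed twice. -/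
  log_nodup : ∀ h ∉ S.byz, ∀ s, (log h s).Nodup
  /-- Honest nodes process only valid messages. -/
  log_valid : ∀ h ∉ S.byz, ∀ s l msg, l ++ [msg] <+: log h s → S.Valid l msg
  /-- Block proofs cannot be forged, and each of them is good for a single block. -/
  block_proof : ∀ h ∉ S.byz, ∀ s P qc txs p τ,
    Msg.block (Block.mk P qc txs (p, τ)) ∈ log h s →
      p ∈ S.proposers ∧ τ ∈ wins p ∧ τ ≤ s ∧ mined p τ = Block.mk P qc txs (p, τ)
  /-- What an honest node has seen reaches all honest nodes within `Δ`, counted from `gst` on. -/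
  delivery : ∀ h ∉ S.byz, ∀ h' ∉ S.byz, ∀ s, ∀ msg ∈ log h s, msg ∈ log h' (max s gst + Δ)
  /-- Votes of honest nodes cannot be forged: they are seen only after they have been cast. -/
  vote_auth : ∀ h ∉ S.byz, ∀ v ∉ S.byz, ∀ s B k,
    Msg.vote v B k ∈ log h s → Msg.vote v B k ∈ log v s
  /-- Nor do they occur in the certificate within a block that is produced earlier. -/
  qc_auth : ∀ p ∈ S.proposers, ∀ τ ∈ wins p, ∀ P qc txs σ, mined p τ = Block.mk P qc txs σ →
    ∀ x ∈ qc, x.1 ∉ S.byz → Msg.vote x.1 P x.2 ∈ log x.1 τ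
  /-- Proposing rule: when an honest proposer finds a block proof, it immediately produces, and
  broadcasts, a block on top of a highest certified block that it has seen. -/
  propose : ∀ p ∈ S.proposers, p ∉ S.byz → ∀ τ ∈ wins p, ∃ l P qc txs,
    (∀ s < τ, log p s <+: l) ∧ l ++ [Msg.block (mined p τ)] <+: log p τ ∧
      mined p τ = Block.mk P qc txs (p, τ) ∧ S.ExtendsHighest l (mined p τ)
  /-- Voting rule: an honest voter immediately votes for a new block that extends a highest
  certified block that it has seen. -/
  vote_cast : ∀ v ∈ S.voters, v ∉ S.byz → ∀ s l B, l ++ [Msg.block B] <+: log v s →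
    S.ExtendsHighest l B →
      ∃ k, S.BallotRule v l B k ∧ l ++ [Msg.block B, Msg.vote v B k] <+: log v s
  /-- Honest voters cast no other votes. -/
  vote_only : ∀ v ∈ S.voters, v ∉ S.byz → ∀ s l B k, l ++ [Msg.vote v B k] <+: log v s →
    ∃ l', l = l' ++ [Msg.block B] ∧ S.ExtendsHighest l' B ∧ S.BallotRule v l' B k

/-! ### Poisson processes -/

/-- The number of points of `W` in the time interval `(0, s]`. -/
noncomputable def count (W : Set ℝ) (s : ℝ≥0) : ℕ := (W ∩ Set.Ioc 0 (s : ℝ)).ncard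

/-- The random set `W` of positive times is the set of arrival times of a Poisson process with
rate `r`. -/
structure IsPoissonProcess {Ω : Type*} [MeasurableSpace Ω] (W : Ω → Set ℝ) (r : ℝ)
    (μ : Measure Ω) : Prop where
  pos : ∀ ω, W ω ⊆ Set.Ioi 0
  locallyFinite : ∀ ω (s : ℝ), (W ω ∩ Set.Ioc 0 s).Finite
  indepIncrements : HasIndepIncrements (fun (s : ℝ≥0) ω => count (W ω) s) μ
  law_increments : ∀ s s' : ℝ≥0, s ≤ s' →
    HasLaw (fun ω => count (W ω) s' - count (W ω) s)
      (poissonMeasure (Real.toNNReal (r * ((s' : ℝ) - s)))) μ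

/-- The lottery with total rate `r`: the `2m + 1` proposers find block proofs according to
independent Poisson processes with rate `r / (2m + 1)` each. -/
structure IsLottery {n m f : ℕ} {Tx : Type} (S : System n m f Tx) {Ω : Type*} [MeasurableSpace Ω]
    (wins : Ω → Fin n → Set ℝ) (r : ℝ) (μ : Measure Ω) : Prop where
  poisson : ∀ p ∈ S.proposers, IsPoissonProcess (fun ω => wins ω p) (r / (2 * m + 1)) μ
  indep : iIndepFun (fun (p : {p // p ∈ S.proposers}) ω (s : ℝ≥0) => count (wins ω p) s) μ

end LBFT

/-! Two message delays after `max s gst`, a block that an honest node has by time `s` has raised the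
certified height of every honest node to at least its own height: one delay spreads the block, one
spreads the votes (`reaches_of_mem`). Call an honest block proof isolated if no other honest proof
lies within `2Δ` of it. After `t₀ + 2Δ`, blocks of isolated proofs have strictly increasing heights,
and no other honest block shares such a height.

If a node sees no second block at the height of an isolated block `B`, it has no evidence for a
witness vote on a child of `B`. Every vote for a certified child is then a commit vote, and `B` is
committed (`mem_mainChain`). So each isolated block that some honest node fails to commit, apart
from the first and the last, is matched by a Byzantine block of equal height. The proof of that
block was found after `t₀`, since the parent of an older one would have been surpassed by the first
isolated block. Different heights need different proofs, so liveness fails only if Byzantine proofs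
number at least the isolated ones minus two (`exists_committed`).

Isolated proofs occur at rate `R * exp (-4RΔ)` with `R = (1 - β)λ`, that is `η² (1 - β) λ`, which
exceeds the Byzantine rate `βλ`. Concentration makes the comparison exponentially reliable. The
isolated proofs are detected on a fine grid of overlapping windows, split into finitely many
families of disjoint windows. Hoeffding's bound applies to each family (`isolated_grid_lower_tail`),
and Chernoff's bound to the Byzantine count (`poisson_tail_le`). -/

namespace LBFT

/-! ### Ancestors, certificates and quorums -/

namespace Block

variable {n : ℕ} {Tx : Type}

theorem exists_ancestor_of_le_height : ∀ (b : Block n Tx) (k : ℕ), k ≤ b.height →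
    ∃ a : Block n Tx, a.height = k ∧ (a = b ∨ a.IsAncestor b)
  | genesis, k, h => ⟨genesis, (Nat.le_zero.1 h).symm, Or.inl rfl⟩
  | mk p qc txs σ, k, h => by
    rcases Nat.lt_or_ge p.height k with hk | hk
    · exact ⟨mk p qc txs σ, le_antisymm hk h, Or.inl rfl⟩
    · obtain ⟨a, ha, hp⟩ := exists_ancestor_of_le_height p k hk
      exact ⟨a, ha, Or.inr hp⟩

theorem height_eq_of_ne_genesis : ∀ {b : Block n Tx}, b ≠ genesis →
    b.height = b.parent.height + 1
  | genesis, h => (h rfl).elim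
  | mk _ _ _ _, _ => rfl

theorem parent_isAncestor : ∀ {b : Block n Tx}, b ≠ genesis → b.parent.IsAncestor b
  | genesis, h => (h rfl).elim
  | mk _ _ _ _, _ => Or.inl rfl

end Block

namespace System

variable {n m f : ℕ} {Tx : Type} {S : System n m f Tx}

theorem Certified.mono {l l' : List (Msg n Tx)} (h : l ⊆ l') {C : Block n Tx}
    (hC : S.Certified l C) : S.Certified l' C := by
  rcases hC with rfl | ⟨hb, hv⟩
  · exact Or.inl rfl
  · refine Or.inr ⟨h hb, hv.trans (Set.ncard_le_ncard ?_ (Set.toFinite _))⟩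
    rintro v ⟨k, hk⟩
    exact ⟨k, h hk⟩

theorem Valid.certified_parent {l : List (Msg n Tx)} : ∀ {B : Block n Tx},
    S.Valid l (Msg.block B) → B ≠ Block.genesis ∧ S.Certified l B.parent
  | Block.genesis, h => h.elim
  | Block.mk P qc txs σ, ⟨h1, h2, _⟩ => by
    refine ⟨by simp, ?_⟩
    rcases h2 with rfl | ⟨hP, hc⟩
    · exact Or.inl rfl
    · refine Or.inr ⟨hP, hc.trans (Set.ncard_le_ncard ?_ (Set.toFinite _))⟩
      rintro v ⟨k, hk⟩
      exact ⟨k, h1 _ hk⟩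

variable (S) in
/-- The messages `l` certify some block of height at least `k`. -/
def Reaches (l : List (Msg n Tx)) (k : ℕ) : Prop :=
  ∃ C, S.Certified l C ∧ k ≤ C.height

theorem Reaches.mono {l l' : List (Msg n Tx)} (h : l ⊆ l') {k : ℕ} (hk : S.Reaches l k) :
    S.Reaches l' k := by
  obtain ⟨C, hC, hkC⟩ := hk
  exact ⟨C, hC.mono h, hkC⟩

theorem Reaches.of_le {l : List (Msg n Tx)} {k k' : ℕ} (h : k' ≤ k) (hk : S.Reaches l k) :
    S.Reaches l k' := by
  obtain ⟨C, hC, hkC⟩ := hk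
  exact ⟨C, hC, h.trans hkC⟩

variable (S) in
theorem card_honest_voters : 2 * f + 1 ≤ (S.voters \ S.byz).card := by
  have h := Finset.card_sdiff_add_card_inter S.voters S.byz
  have h' := S.card_byz_voters
  have h'' := S.card_voters
  rw [Finset.inter_comm] at h'
  omega

variable (S) in
theorem exists_honest_of_card_le {s : Set (Fin n)} (hs : s ⊆ S.voters)
    (hc : 2 * f + 1 ≤ s.ncard) : ∃ v ∈ s, v ∉ S.byz := by
  by_contra! h
  have hsub : s ⊆ ((S.byz ∩ S.voters : Finset (Fin n)) : Set (Fin n)) := fun v hv => by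
    simpa using ⟨h v hv, hs hv⟩
  have h1 := Set.ncard_le_ncard hsub (Set.toFinite _)
  rw [Set.ncard_coe_finset] at h1
  have := S.card_byz_voters
  omega

end System

/-! ### Growth of the certified height, and commitment -/

namespace IsExecution

open LBFT.System

variable {n m f : ℕ} {Tx : Type} {S : System n m f Tx} {Δ gst : ℝ} {wins : Fin n → Set ℝ}
  {mined : Fin n → ℝ → Block n Tx} {log : Fin n → ℝ → List (Msg n Tx)}

theorem log_subset (hE : IsExecution S Δ gst wins mined log) {h : Fin n} (hh : h ∉ S.byz)
    {s s' : ℝ} (hs : s ≤ s') : log h s ⊆ log h s' :=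
  (hE.log_mono h hh s s' hs).subset

theorem exists_prefix_of_mem {α : Type*} {l : List α} {x : α} (hx : x ∈ l) :
    ∃ l', l' ++ [x] <+: l := by
  obtain ⟨s, t, rfl⟩ := List.append_of_mem hx
  exact ⟨s, t, by simp⟩

theorem valid_of_mem (hE : IsExecution S Δ gst wins mined log) {h : Fin n} (hh : h ∉ S.byz)
    {s : ℝ} {l : List (Msg n Tx)} (hl : l <+: log h s) {x : Msg n Tx} (hx : x ∈ l) :
    ∃ l', l' ⊆ l ∧ S.Valid l' x := by
  obtain ⟨l', hl'⟩ := exists_prefix_of_mem hx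
  exact ⟨l', fun y hy => hl'.subset (by simp [hy]), hE.log_valid h hh s l' x (hl'.trans hl)⟩

theorem certified_parent (hE : IsExecution S Δ gst wins mined log) {h : Fin n} (hh : h ∉ S.byz)
    {s : ℝ} {l : List (Msg n Tx)} (hl : l <+: log h s) {B : Block n Tx} (hB : Msg.block B ∈ l) :
    B ≠ Block.genesis ∧ S.Certified l B.parent := by
  obtain ⟨l', hl', hv⟩ := hE.valid_of_mem hh hl hB
  exact ⟨hv.certified_parent.1, hv.certified_parent.2.mono hl'⟩

theorem certified_ancestor (hE : IsExecution S Δ gst wins mined log) {h : Fin n}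
    (hh : h ∉ S.byz) {s : ℝ} {l : List (Msg n Tx)} (hl : l <+: log h s) {A : Block n Tx} :
    ∀ {B : Block n Tx}, S.Certified l B → A.IsAncestor B → S.Certified l A
  | Block.genesis, _, hA => hA.elim
  | Block.mk P qc txs σ, hB, hA => by
    have hP : S.Certified l P := by
      rcases hB with hB | hB
      · cases hB
      · exact (hE.certified_parent hh hl hB.1).2
    rcases hA with rfl | hA
    · exact hP
    · exact certified_ancestor hE hh hl hP hA

/-- A valid block comes after its certified parent in the log, so logs are closed under ancestors.
Uniqueness at one height thereby constrains all higher blocks. -/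
theorem mem_of_ancestor (hE : IsExecution S Δ gst wins mined log) {h : Fin n}
    (hh : h ∉ S.byz) {s : ℝ} {l : List (Msg n Tx)} (hl : l <+: log h s) {A B : Block n Tx}
    (hB : Msg.block B ∈ l) (hA : A.IsAncestor B) (hA0 : A ≠ Block.genesis) :
    Msg.block A ∈ l := by
  have hP := hE.certified_parent hh hl hB
  have hcA : S.Certified l A := by
    cases B with
    | genesis => exact hA.elim
    | mk P qc txs σ =>
      rcases hA with rfl | hA
      · exact hP.2
      · exact hE.certified_ancestor hh hl hP.2 hA
  rcases hcA with h0 | h0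
  · exact (hA0 h0).elim
  · exact h0.1

theorem exists_certified_of_reaches (hE : IsExecution S Δ gst wins mined log) {h : Fin n}
    (hh : h ∉ S.byz) {s : ℝ} {l : List (Msg n Tx)} (hl : l <+: log h s) {k : ℕ}
    (hk : S.Reaches l k) : ∃ C, S.Certified l C ∧ C.height = k := by
  obtain ⟨C, hC, hkC⟩ := hk
  obtain ⟨A, hA, rfl | hA'⟩ := Block.exists_ancestor_of_le_height C k hkC
  · exact ⟨A, hC, hA⟩
  · exact ⟨A, hE.certified_ancestor hh hl hC hA', hA⟩

theorem reaches_delivery (hE : IsExecution S Δ gst wins mined log) {h h' : Fin n}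
    (hh : h ∉ S.byz) (hh' : h' ∉ S.byz) {s : ℝ} {k : ℕ} (hk : S.Reaches (log h s) k) :
    S.Reaches (log h' (max s gst + Δ)) k :=
  hk.mono fun msg hmsg => hE.delivery h hh h' hh' s msg hmsg

/-- A voter that processes a block votes for it, unless it has already seen a certified block that
is at least as high. -/
theorem vote_or_reaches (hE : IsExecution S Δ gst wins mined log) {v : Fin n}
    (hv : v ∈ S.voters) (hvb : v ∉ S.byz) {s : ℝ} {B : Block n Tx}
    (hB : Msg.block B ∈ log v s) :
    (∃ k, Msg.vote v B k ∈ log v s) ∨ S.Reaches (log v s) B.height := by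
  obtain ⟨l, hl⟩ := exists_prefix_of_mem hB
  obtain ⟨hB0, hpar⟩ := (hE.log_valid v hvb s l _ hl).certified_parent
  by_cases hext : S.ExtendsHighest l B
  · obtain ⟨k, -, hk⟩ := hE.vote_cast v hv hvb s l B hl hext
    exact Or.inl ⟨k, hk.subset (by simp)⟩
  · simp only [ExtendsHighest, not_and, not_forall, not_le] at hext
    obtain ⟨C, hC, hlt⟩ := hext hpar
    refine Or.inr ⟨C, hC.mono fun y hy => hl.subset (by simp [hy]), ?_⟩
    rw [Block.height_eq_of_ne_genesis hB0]
    exact hlt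

/-- After one delay every honest voter has `B`. Either one of them knows a certified block at least
as high, which a second delay spreads, or all of them vote for `B`, and the second delay spreads
these `2f + 1` votes. -/
theorem reaches_of_mem (hE : IsExecution S Δ gst wins mined log) (hΔ : 0 < Δ) {p h : Fin n}
    (hp : p ∉ S.byz) (hh : h ∉ S.byz) {s : ℝ} {B : Block n Tx} (hB : Msg.block B ∈ log p s) :
    S.Reaches (log h (max s gst + 2 * Δ)) B.height := by
  have e : max (max s gst + Δ) gst + Δ = max s gst + 2 * Δ := by
    rw [max_eq_left (by linarith [le_max_right s gst])]; ring
  have hBv : ∀ v ∉ S.byz, Msg.block B ∈ log v (max s gst + Δ) := fun v hv =>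
    hE.delivery p hp v hv s _ hB
  by_cases hr : ∃ v ∉ S.byz, S.Reaches (log v (max s gst + Δ)) B.height
  · obtain ⟨v, hv, hr⟩ := hr
    rw [← e]
    exact hE.reaches_delivery hv hh hr
  · push Not at hr
    refine ⟨B, Or.inr ⟨?_, ?_⟩, le_rfl⟩
    · exact hE.log_subset hh (by linarith) (hBv h hh)
    · refine (S.card_honest_voters).trans ?_
      rw [← Set.ncard_coe_finset]
      refine Set.ncard_le_ncard ?_ (Set.toFinite _)
      intro v hv
      obtain ⟨hv1, hv2⟩ := Finset.mem_sdiff.1 (Finset.mem_coe.1 hv)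
      rcases hE.vote_or_reaches hv1 hv2 (hBv v hv2) with ⟨k, hk⟩ | h'
      · refine ⟨k, ?_⟩
        rw [← e]
        exact hE.delivery v hv2 h hh _ _ hk
      · exact (hr v hv2 h').elim

theorem mined_mem (hE : IsExecution S Δ gst wins mined log) {p : Fin n} (hp : p ∈ S.proposers)
    (hpb : p ∉ S.byz) {τ : ℝ} (hτ : τ ∈ wins p) : Msg.block (mined p τ) ∈ log p τ := by
  obtain ⟨l, P, qc, txs, -, h2, -, -⟩ := hE.propose p hp hpb τ hτ
  exact h2.subset (by simp)

/-- The proposer's log at the moment of proposing extends its log at every earlier time, but need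
not contain all of `log p τ`; hence the strict `s < τ`. -/
theorem lt_height_mined (hE : IsExecution S Δ gst wins mined log) {p : Fin n}
    (hp : p ∈ S.proposers) (hpb : p ∉ S.byz) {τ : ℝ} (hτ : τ ∈ wins p) {s : ℝ} (hs : s < τ)
    {k : ℕ} (hk : S.Reaches (log p s) k) : k < (mined p τ).height := by
  obtain ⟨l, P, qc, txs, h1, h2, h3, h4⟩ := hE.propose p hp hpb τ hτ
  obtain ⟨C, hC, hkC⟩ := hk
  have := h4.2 C (hC.mono (h1 s hs).subset)
  rw [h3] at this ⊢
  exact Nat.lt_succ_of_le (hkC.trans this)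

theorem height_lt_height (hE : IsExecution S Δ gst wins mined log) (hΔ : 0 < Δ) {p q : Fin n}
    (hp : p ∈ S.proposers) (hpb : p ∉ S.byz) (hq : q ∈ S.proposers) (hqb : q ∉ S.byz) {σ τ : ℝ}
    (hσ : σ ∈ wins p) (hτ : τ ∈ wins q) (h : max σ gst + 2 * Δ < τ) :
    (mined p σ).height < (mined q τ).height :=
  hE.lt_height_mined hq hqb hτ h (hE.reaches_of_mem hΔ hpb hqb (hE.mined_mem hp hpb hσ))

/-- When a block is produced, its parent has been known to an honest voter. -/
theorem reaches_parent (hE : IsExecution S Δ gst wins mined log) (hΔ : 0 < Δ) {h h' : Fin n}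
    (hh : h ∉ S.byz) (hh' : h' ∉ S.byz) {s : ℝ} {P : Block n Tx}
    {qc : List (Fin n × Ballot (Block n Tx))} {txs : List Tx} {q : Fin n} {σ : ℝ}
    (hW : Msg.block (Block.mk P qc txs (q, σ)) ∈ log h s) :
    S.Reaches (log h' (max σ gst + 2 * Δ)) P.height := by
  obtain ⟨hq, hσ, -, hm⟩ := hE.block_proof h hh s P qc txs q σ hW
  obtain ⟨l', hl', hval⟩ := hE.valid_of_mem hh (List.prefix_rfl) hW
  obtain ⟨h1, h2, -⟩ := hval
  rcases h2 with rfl | ⟨hP, hc⟩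
  · exact ⟨Block.genesis, Or.inl rfl, le_rfl⟩
  · obtain ⟨v, ⟨k, hk⟩, hvb⟩ := S.exists_honest_of_card_le
      (s := {v : Fin n | ∃ k, (v, k) ∈ qc}) (by
        rintro v ⟨k, hk⟩
        obtain ⟨l'', -, hv⟩ := hE.valid_of_mem hh (List.prefix_rfl) (hl' (h1 _ hk))
        cases k with
        | comVote => exact hv.1
        | witVote W => exact hv.1) hc
    -- The block may be withheld for long, but the honest vote in its certificate was cast by time
    -- `σ`, and its voter had `P` by then.
    have hvote := hE.qc_auth q hq σ hσ P qc txs _ hm _ hk hvb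
    obtain ⟨l'', hl'', hv⟩ := hE.valid_of_mem hvb (List.prefix_rfl) hvote
    refine hE.reaches_of_mem hΔ hvb hh' (s := σ) (hl'' ?_)
    cases k with
    | comVote => exact hv.2
    | witVote W => exact hv.2.1

/-- If `B` is the only block of its height that a node has seen, and the node has seen a higher
certified block, then it has committed `B`. -/
theorem mem_mainChain (hE : IsExecution S Δ gst wins mined log) {h : Fin n} (hh : h ∉ S.byz)
    {s : ℝ} {B : Block n Tx} (hB : B ≠ Block.genesis)
    (huniq : ∀ A, Msg.block A ∈ log h s → A.height = B.height → A = B)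
    (hr : S.Reaches (log h s) (B.height + 1)) : B ∈ S.mainChain (log h s) := by
  obtain ⟨C, hC, hCh⟩ := hE.exists_certified_of_reaches hh List.prefix_rfl hr
  have hC0 : C ≠ Block.genesis := by
    rintro rfl
    exact absurd hCh (by simp [Block.height])
  have hC' := hC.resolve_left hC0
  -- The ancestor of `A` at the height of `B` is in the log too, so it is `B`.
  have key : ∀ A, Msg.block A ∈ log h s → B.height ≤ A.height → A = B ∨ B.IsAncestor A := by
    intro A hA hle
    obtain ⟨D, hD, rfl | hD'⟩ := Block.exists_ancestor_of_le_height A _ hle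
    · exact Or.inl (huniq _ hA hD)
    · have hD0 : D ≠ Block.genesis := by
        rintro rfl
        rw [Block.height_eq_of_ne_genesis hB] at hD
        exact absurd hD (by simp [Block.height])
      have := huniq D (hE.mem_of_ancestor hh List.prefix_rfl hA hD' hD0) hD
      exact Or.inr (this ▸ hD')
  have hpar : C.parent = B := by
    have hhp : C.parent.height = B.height := by
      have := Block.height_eq_of_ne_genesis hC0
      omega
    have hp0 : C.parent ≠ Block.genesis := by
      intro h0
      rw [h0, Block.height_eq_of_ne_genesis hB] at hhp
      exact absurd hhp (by simp [Block.height])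
    exact huniq _ (hE.mem_of_ancestor hh List.prefix_rfl hC'.1
      (Block.parent_isAncestor hC0) hp0) hhp
  refine ⟨C, hpar ▸ Block.parent_isAncestor hC0, hC, hC'.2.trans
    (Set.ncard_le_ncard ?_ (Set.toFinite _))⟩
  rintro v ⟨k, hk⟩
  cases k with
  | comVote => exact hk
  -- The evidence would conflict with `B` and be no lower, but every such block in the log is `B` or
  -- a descendant of `B`.
  | witVote W =>
    obtain ⟨l', hl', -, -, hW, hconf, hle⟩ := hE.valid_of_mem hh List.prefix_rfl hk
    rw [hpar] at hconf hle
    rcases key W (hl' hW) hle with h1 | h1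
    · exact (hconf.1 h1).elim
    · exact (hconf.2.2 h1).elim

end IsExecution
end LBFT

/-! ### Counting isolated against Byzantine proofs -/

namespace LBFT
namespace IsExecution

variable {n m f : ℕ} {Tx : Type} {S : System n m f Tx} {Δ gst : ℝ} {wins : Fin n → Set ℝ}
  {mined : Fin n → ℝ → Block n Tx} {log : Fin n → ℝ → List (Msg n Tx)}

/-- If there are at least three more isolated honest block proofs than Byzantine block proofs, then
some honest block is committed by all honest nodes. -/
theorem exists_committed (hE : IsExecution S Δ gst wins mined log) (hΔ : 0 < Δ) {t₀ t : ℝ}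
    (ht₀ : gst ≤ t₀) (G : Finset ℕ) (p : ℕ → Fin n) (τ : ℕ → ℝ)
    (hp : ∀ j ∈ G, p j ∈ S.proposers) (hpb : ∀ j ∈ G, p j ∉ S.byz)
    (hτ : ∀ j ∈ G, τ j ∈ wins (p j))
    (hlone : ∀ j ∈ G, ∀ q ∈ S.proposers, q ∉ S.byz → ∀ σ ∈ wins q, (q, σ) ≠ (p j, τ j) →
      σ < τ j - 2 * Δ ∨ τ j + 2 * Δ < σ)
    (hmono : ∀ i ∈ G, ∀ j ∈ G, i < j → τ i < τ j)
    (hlo : ∀ j ∈ G, t₀ + 2 * Δ < τ j) (hhi : ∀ j ∈ G, τ j + 2 * Δ ≤ t₀ + t)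
    (Z : Finset (Fin n × ℝ))
    (hZ : ∀ q ∈ S.proposers, q ∈ S.byz → ∀ σ ∈ wins q, t₀ < σ → σ ≤ t₀ + t → (q, σ) ∈ Z)
    (hcard : Z.card + 2 < G.card) :
    ∃ p ∈ S.proposers, p ∉ S.byz ∧ ∃ τ ∈ wins p, t₀ < τ ∧ τ ≤ t₀ + t ∧
      ∀ h ∉ S.byz, mined p τ ∈ S.mainChain (log h (t₀ + t)) := by
  by_contra hcon
  push Not at hcon
  have hne : G.Nonempty := Finset.card_pos.1 (by omega)
  set a := G.min' hne with ha
  set b := G.max' hne with hb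
  have haG : a ∈ G := G.min'_mem hne
  have hbG : b ∈ G := G.max'_mem hne
  let H : ℕ → ℕ := fun j => (mined (p j) (τ j)).height
  have hH : ∀ i ∈ G, ∀ j ∈ G, i < j → H i < H j := by
    intro i hi j hj hij
    have h1 := hmono i hi j hj hij
    have h2 := hlo i hi
    refine hE.height_lt_height hΔ (hp i hi) (hpb i hi) (hp j hj) (hpb j hj) (hτ i hi) (hτ j hj) ?_
    rw [max_eq_left (by linarith)]
    rcases hlone j hj (p i) (hp i hi) (hpb i hi) (τ i) (hτ i hi)
      (fun h => h1.ne (Prod.ext_iff.1 h).2) with h | h <;> linarith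
  have huniq : ∀ j ∈ G, ∀ q ∈ S.proposers, q ∉ S.byz → ∀ σ ∈ wins q,
      (mined q σ).height = H j → (q, σ) = (p j, τ j) := by
    intro j hj q hq hqb σ hσ hh
    by_contra hne'
    have h2 := hlo j hj
    rcases hlone j hj q hq hqb σ hσ hne' with h | h
    · have := hE.height_lt_height hΔ hq hqb (hp j hj) (hpb j hj) hσ (hτ j hj)
        -- If `σ` precedes `gst`, the delays count from `gst ≤ t₀`; the margin `t₀ + 2Δ < τ j`
        -- covers this case.
        (by rcases max_cases σ gst with ⟨e, -⟩ | ⟨e, -⟩ <;> rw [e] <;> linarith)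
      exact this.ne hh
    · have := hE.height_lt_height hΔ (hp j hj) (hpb j hj) hq hqb (hτ j hj) hσ
        (by rw [max_eq_left (by linarith)]; exact h)
      exact this.ne' hh
  -- The last isolated block `b` makes a height above `H j` certified in time; the first one, `a`,
  -- will rule out old Byzantine proofs. Hence both are removed.
  have key : ∀ j, ∃ z : Fin n × ℝ, j ∈ (G.erase a).erase b →
      z ∈ Z ∧ (mined z.1 z.2).height = H j := by
    intro j
    by_cases hjm : j ∈ (G.erase a).erase b
    swap
    · exact ⟨(p a, 0), fun h => (hjm h).elim⟩
    simp only [Finset.mem_erase] at hjm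
    obtain ⟨hjb, hja, hj⟩ := hjm
    have haj : a < j := lt_of_le_of_ne (G.min'_le j hj) (Ne.symm hja)
    have hjb' : j < b := lt_of_le_of_ne (G.le_max' j hj) hjb
    have hloj := hlo j hj
    obtain ⟨h, hh, hnot⟩ := hcon (p j) (hp j hj) (hpb j hj) (τ j) (hτ j hj) (by linarith)
      (by linarith [hhi j hj])
    have hreach : S.Reaches (log h (t₀ + t)) (H j + 1) := by
      have h1 := hE.reaches_of_mem hΔ (hpb b hbG) hh
        (hE.mined_mem (hp b hbG) (hpb b hbG) (hτ b hbG))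
      refine (h1.mono (hE.log_subset hh ?_)).of_le (hH j hj b hbG hjb')
      rw [max_eq_left (by linarith [hlo b hbG])]
      exact hhi b hbG
    have hgen : mined (p j) (τ j) ≠ Block.genesis :=
      (hE.certified_parent (hpb j hj) List.prefix_rfl
        (hE.mined_mem (hp j hj) (hpb j hj) (hτ j hj))).1
    have hex : ∃ A, Msg.block A ∈ log h (t₀ + t) ∧ A.height = H j ∧ A ≠ mined (p j) (τ j) := by
      by_contra! hno
      exact hnot (hE.mem_mainChain hh hgen hno hreach)
    obtain ⟨A, hA, hAh, hAne⟩ := hex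
    cases A with
    | genesis => exact ((hE.certified_parent hh List.prefix_rfl hA).1 rfl).elim
    | mk P qc txs z =>
      obtain ⟨q, σ⟩ := z
      obtain ⟨hq, hσ, hσt, hm⟩ := hE.block_proof h hh _ P qc txs q σ hA
      have hqb : q ∈ S.byz := by
        by_contra hqb
        have := huniq j hj q hq hqb σ hσ (by rw [hm, hAh])
        rw [Prod.mk.injEq] at this
        rw [← this.1, ← this.2, hm] at hAne
        exact hAne rfl
      refine ⟨(q, σ), fun _ => ⟨hZ q hq hqb σ hσ ?_ hσt, by rw [hm, hAh]⟩⟩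
      -- If `σ ≤ t₀`, the proposer of `a` knows a certified block as high as `P` before `τ a`. Then
      -- `H a ≥ P.height + 1 = H j`, against `H a < H j`.
      by_contra! hle
      have h1 := hE.reaches_parent hΔ hh (hpb a haG) hA
      have h2 := hE.lt_height_mined (hp a haG) (hpb a haG) (hτ a haG)
        (by
          have := hlo a haG
          rcases max_cases σ gst with ⟨e, -⟩ | ⟨e, -⟩ <;> rw [e] <;> linarith) h1
      have h3 := hH a haG j hj haj
      have h4 : P.height + 1 = H j := hAh
      have h5 : P.height < H a := h2
      omega
  choose g hg using key
  have hinj : Set.InjOn g ((G.erase a).erase b : Finset ℕ) := by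
    intro i hi j hj hij
    have h1 := (hg i hi).2
    have h2 := (hg j hj).2
    rw [hij, h2] at h1
    have hiG : i ∈ G := Finset.mem_of_mem_erase (Finset.mem_of_mem_erase hi)
    have hjG : j ∈ G := Finset.mem_of_mem_erase (Finset.mem_of_mem_erase hj)
    rcases lt_trichotomy i j with h | h | h
    · exact ((hH i hiG j hjG h).ne' h1).elim
    · exact h
    · exact ((hH j hjG i hiG h).ne h1).elim
  have hle := Finset.card_le_card_of_injOn g (fun j hj => (hg j hj).1) hinj
  have h1 := Finset.pred_card_le_card_erase (s := G) (a := a)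
  have h2 := Finset.pred_card_le_card_erase (s := G.erase a) (a := b)
  omega

end IsExecution
end LBFT

/-! ### Independence and tail bounds -/

namespace LBFT

section Independence

variable {Ω : Type*} [MeasurableSpace Ω] {μ : Measure Ω}

/-- Joint independence means that the joint law is a product measure; currying the index set turns
it into a product of the laws of the rows. -/
theorem iIndepFun_curry {ι κ β : Type*} [Countable ι] [Countable κ] [MeasurableSpace β]
    {X : ι → κ → Ω → β} (hX : ∀ i k, Measurable (X i k))
    (h : iIndepFun (fun (p : ι × κ) ω => X p.1 p.2 ω) μ) :
    iIndepFun (fun i ω k => X i k ω) μ := by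
  have := h.isProbabilityMeasure
  have hp : ∀ i k, IsProbabilityMeasure (μ.map (X i k)) := fun i k =>
    Measure.isProbabilityMeasure_map (hX i k).aemeasurable
  rw [iIndepFun_iff_map_fun_eq_infinitePi_map (by fun_prop)]
  have h1 := (iIndepFun_iff_map_fun_eq_infinitePi_map (by fun_prop)).1 h
  have h2 : ∀ i, μ.map (fun ω k => X i k ω) = Measure.infinitePi fun k => μ.map (X i k) := by
    intro i
    refine (iIndepFun_iff_map_fun_eq_infinitePi_map (by fun_prop)).1 ?_
    exact h.precomp (g := fun k => (i, k)) (fun a b hab => (Prod.ext_iff.1 hab).2)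
  simp_rw [h2]
  rw [← Measure.infinitePi_map_curry (fun i k => μ.map (X i k)), ← h1,
    Measure.map_map (by fun_prop) (by fun_prop)]
  rfl

/-- Sums over one index of a doubly indexed independent family are independent. -/
theorem iIndepFun_sum_of_indep {ι κ : Type*} [Fintype ι] [Countable κ]
    {X : ι → κ → Ω → ℕ} (hX : ∀ i k, AEMeasurable (X i k) μ)
    (h1 : iIndepFun (fun i ω k => X i k ω) μ) (h2 : ∀ i, iIndepFun (X i) μ) :
    iIndepFun (fun k ω => ∑ i, X i k ω) μ := by
  let Y : ι → κ → Ω → ℕ := fun i k => (hX i k).mk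
  have hY : ∀ i k, Measurable (Y i k) := fun i k => (hX i k).measurable_mk
  have hXY : ∀ i k, X i k =ᵐ[μ] Y i k := fun i k => (hX i k).ae_eq_mk
  have hXY' : ∀ i, (fun ω k => X i k ω) =ᵐ[μ] (fun ω k => Y i k ω) := by
    intro i
    filter_upwards [ae_all_iff.2 (hXY i)] with ω hω
    funext k
    exact hω k
  -- Independence across rows and within each row gives independence of the whole array, which can
  -- then be regrouped by columns.
  have h3 : iIndepFun (fun (p : ι × κ) ω => Y p.1 p.2 ω) μ :=
    iIndepFun_uncurry' hY (h1.congr hXY') fun i => (h2 i).congr (hXY i)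
  have h4 : iIndepFun (fun (p : κ × ι) ω => Y p.2 p.1 ω) μ :=
    h3.precomp (g := Prod.swap) Prod.swap_injective
  have h5 := iIndepFun_curry (X := fun k i => Y i k) (fun k i => hY i k) h4
  have h6 := h5.comp (fun _ (y : ι → ℕ) => ∑ i, y i) (fun _ => by fun_prop)
  refine h6.congr fun k => ?_
  have : ∀ᵐ ω ∂μ, ∀ i, X i k ω = Y i k ω := ae_all_iff.2 fun i => hXY i k
  filter_upwards [this] with ω hω
  simp [hω]

theorem iIndepFun_triples {D : ℕ → Ω → ℕ} (hD : ∀ j, AEMeasurable (D j) μ)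
    (h : iIndepFun D μ) :
    iIndepFun (fun i ω (k : Fin 3) => D (3 * i + k) ω) μ := by
  let Y : ℕ → Ω → ℕ := fun k => (hD k).mk
  have hY : ∀ k, Measurable (Y k) := fun k => (hD k).measurable_mk
  have hDY : ∀ k, D k =ᵐ[μ] Y k := fun k => (hD k).ae_eq_mk
  have h1 : iIndepFun (fun (p : ℕ × Fin 3) ω => Y (3 * p.1 + p.2) ω) μ := by
    refine (h.congr hDY).precomp (g := fun p : ℕ × Fin 3 => 3 * p.1 + (p.2 : ℕ)) ?_
    rintro ⟨a, i⟩ ⟨b, j⟩ hab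
    simp only at hab
    ext <;> simp <;> omega
  refine (iIndepFun_curry (X := fun i (k : Fin 3) => Y (3 * i + k)) (fun _ _ => hY _) h1).congr ?_
  intro i
  have : ∀ᵐ ω ∂μ, ∀ k : Fin 3, D (3 * i + k) ω = Y (3 * i + k) ω :=
    ae_all_iff.2 fun k => hDY _
  filter_upwards [this] with ω hω
  funext k
  exact (hω k).symm

theorem poissonMeasure_zero : poissonMeasure 0 = Measure.dirac 0 := by
  refine Measure.ext_of_singleton fun k => ?_
  rw [poissonMeasure_singleton]
  rcases k with _ | k <;> simp

theorem hasLaw_sum_poisson [IsProbabilityMeasure μ] {ι : Type*} {X : ι → Ω → ℕ} {r : ι → ℝ≥0}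
    (hX : ∀ i, HasLaw (X i) (poissonMeasure (r i)) μ) (h : iIndepFun X μ) (s : Finset ι) :
    HasLaw (fun ω => ∑ i ∈ s, X i ω) (poissonMeasure (∑ i ∈ s, r i)) μ := by
  classical
  induction s using Finset.induction_on with
  | empty =>
    simp only [Finset.sum_empty]
    rw [poissonMeasure_zero]
    exact ⟨aemeasurable_const, by simp⟩
  | insert a s ha ih =>
    have h1 := h.indepFun_finsetSum_of_notMem₀ (fun i => (hX i).aemeasurable) ha
    have h2 : (∑ i ∈ s, X i) = fun ω => ∑ i ∈ s, X i ω := by ext; simp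
    rw [h2] at h1
    have h3 := h1.symm.hasLaw_add_poissonMeasure (hX a) ih
    rw [Finset.sum_insert ha]
    simp_rw [Finset.sum_insert ha]
    exact h3

/-- The Chernoff bound for the upper tail of a Poisson random variable. -/
theorem poisson_tail_le [IsProbabilityMeasure μ] {Z : Ω → ℕ} {r : ℝ≥0}
    (hZ : HasLaw Z (poissonMeasure r) μ) {s : ℝ} (hs : 0 ≤ s) (x : ℝ) :
    μ.real {ω | x ≤ Z ω} ≤ Real.exp (-s * x + r * (Real.exp s - 1)) := by
  have hsum : HasSum (fun k : ℕ => Real.exp (-r) * r ^ k / k.factorial * Real.exp (s * k))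
      (Real.exp (r * (Real.exp s - 1))) := by
    convert! (NormedSpace.expSeries_div_hasSum_exp ((r : ℝ) * Real.exp s)).mul_left
      (Real.exp (-r)) using 1
    · funext k
      rw [mul_pow, ← Real.exp_nat_mul, mul_comm (k : ℝ) s]
      ring
    · rw [← Real.exp_eq_exp_ℝ, ← Real.exp_add]
      ring_nf
  have hint : Integrable (fun k : ℕ => Real.exp (s * k)) (poissonMeasure r) := by
    rw [integrable_poissonMeasure_iff]
    simpa using hsum.summable
  have hmgf : mgf (fun k : ℕ => (k : ℝ)) (poissonMeasure r) s =
      Real.exp (r * (Real.exp s - 1)) := by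
    rw [mgf, integral_poissonMeasure]
    simpa using hsum.tsum_eq
  rw [hZ.measureReal_eq (p := fun k : ℕ => x ≤ k) (by measurability), Real.exp_add, ← hmgf]
  exact measure_ge_le_exp_mul_mgf x hs hint

/-- Hoeffding's bound for the lower tail of the number of successes. -/
theorem hoeffding_lower_tail [IsProbabilityMeasure μ] {X : ℕ → Ω → ℝ} (hX : iIndepFun X μ)
    (hm : ∀ i, AEMeasurable (X i) μ) (h01 : ∀ i ω, X i ω ∈ Set.Icc 0 1) {q κ : ℝ} (hκ : 0 ≤ κ)
    (hq : ∀ i, ∫ ω, X i ω ∂μ = q) (k : ℕ) :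
    μ.real {ω | ∑ i ∈ Finset.range k, X i ω ≤ k * (q - κ)} ≤ Real.exp (-2 * k * κ ^ 2) := by
  have hsub : ∀ i < k, HasSubgaussianMGF (fun ω => -X i ω + q) (1 / 4) μ := by
    intro i _
    have h := hasSubgaussianMGF_of_mem_Icc (μ := μ) (X := fun ω => -X i ω) (a := -1) (b := 0)
      (hm i).neg (ae_of_all _ fun ω => by
        have := h01 i ω
        exact ⟨by linarith [this.2], by linarith [this.1]⟩)
    -- Hoeffding's lemma on an interval of length 1: variance proxy `(1/2)²`.
    have e : ((‖(0 : ℝ) - -1‖₊ / 2) ^ 2 : ℝ≥0) = 1 / 4 := by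
      norm_num
    rw [e] at h
    simpa [integral_neg, hq i] using h
  have hind : iIndepFun (fun i ω => -X i ω + q) μ :=
    hX.comp (fun _ x => -x + q) (fun _ => by fun_prop)
  have h := HasSubgaussianMGF.measure_sum_range_ge_le_of_iIndepFun hind hsub (n := k)
    (ε := k * κ) (by positivity)
  have hset : {ω | ∑ i ∈ Finset.range k, X i ω ≤ k * (q - κ)} =
      {ω | k * κ ≤ ∑ i ∈ Finset.range k, (-X i ω + q)} := by
    ext ω
    simp only [Set.mem_ofPred_eq, Finset.sum_add_distrib, Finset.sum_neg_distrib,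
      Finset.sum_const, Finset.card_range, nsmul_eq_mul]
    constructor <;> intro h <;> linarith
  rw [hset]
  refine h.trans (le_of_eq ?_)
  congr 1
  rcases Nat.eq_zero_or_pos k with rfl | hk
  · simp
  · have : (k : ℝ) ≠ 0 := by positivity
    push_cast
    field_simp
    norm_num

end Independence

end LBFT

/-! ### Poisson increments and isolated proofs -/

namespace LBFT

/-- Finiteness is essential: `ncard` is 0 on infinite sets, and the truncated subtraction is exact
only for monotone counts. -/
theorem count_sub_count {W : Set ℝ} {s s' : ℝ≥0} (h : s ≤ s')
    (hW : (W ∩ Set.Ioc 0 (s' : ℝ)).Finite) :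
    count W s' - count W s = (W ∩ Set.Ioc (s : ℝ) s').ncard := by
  have hs : (s : ℝ) ≤ s' := by exact_mod_cast h
  have hu : W ∩ Set.Ioc 0 (s' : ℝ) = (W ∩ Set.Ioc 0 (s : ℝ)) ∪ (W ∩ Set.Ioc (s : ℝ) s') := by
    rw [← Set.inter_union_distrib_left, Set.Ioc_union_Ioc_eq_Ioc s.coe_nonneg hs]
  have hd : Disjoint (W ∩ Set.Ioc 0 (s : ℝ)) (W ∩ Set.Ioc (s : ℝ) s') := by
    rw [Set.disjoint_left]
    rintro x ⟨-, h1⟩ ⟨-, h2⟩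
    exact absurd h2.1 (not_lt.2 h1.2)
  have := Set.ncard_union_eq hd (hW.subset (hu ▸ Set.subset_union_left))
    (hW.subset (hu ▸ Set.subset_union_right))
  rw [count, count, hu, this, Nat.add_sub_cancel_left]

/-- The number of block proofs found by the proposers in `P` between the times `s` and `s'`. -/
noncomputable def increment {n : ℕ} (W : Fin n → Set ℝ) (P : Finset (Fin n)) (s s' : ℝ≥0) : ℕ :=
  ∑ p : P, (count (W p) s' - count (W p) s)

/-- The block proofs found by the proposers in `P` between the times `s` and `s'`. -/
def proofs {n : ℕ} (W : Fin n → Set ℝ) (P : Finset (Fin n)) (s s' : ℝ) : Set (Fin n × ℝ) :=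
  {z | z.1 ∈ P ∧ z.2 ∈ W z.1 ∧ z.2 ∈ Set.Ioc s s'}

theorem proofs_finite {n : ℕ} {W : Fin n → Set ℝ} {P : Finset (Fin n)} {s s' : ℝ} (hs : 0 ≤ s)
    (hW : ∀ p ∈ P, (W p ∩ Set.Ioc 0 s').Finite) : (proofs W P s s').Finite := by
  have : proofs W P s s' ⊆ ⋃ p ∈ P, (fun x => (p, x)) '' (W p ∩ Set.Ioc 0 s') := by
    rintro ⟨p, x⟩ ⟨h1, h2, h3⟩
    simp only [Set.mem_iUnion]
    exact ⟨p, h1, x, ⟨h2, hs.trans_lt h3.1, h3.2⟩, rfl⟩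
  exact (P.finite_toSet.biUnion fun p hp => (hW p hp).image _).subset this

theorem increment_eq_ncard {n : ℕ} {W : Fin n → Set ℝ} {P : Finset (Fin n)} {s s' : ℝ≥0}
    (h : s ≤ s') (hW : ∀ p ∈ P, (W p ∩ Set.Ioc 0 (s' : ℝ)).Finite) :
    increment W P s s' = (proofs W P s s').ncard := by
  classical
  have hfin := proofs_finite s.coe_nonneg hW
  rw [Set.ncard_eq_toFinset_card _ hfin,
    Finset.card_eq_sum_card_fiberwise (f := Prod.fst) (t := P)
      (fun z hz => ((hfin.mem_toFinset).1 hz).1), increment, ← Finset.sum_coe_sort P]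
  refine Finset.sum_congr rfl fun p _ => ?_
  rw [count_sub_count h (hW p p.2), ← Set.ncard_coe_finset]
  refine Set.ncard_congr (fun x _ => (p.1, x)) ?_ ?_ ?_
  · rintro x ⟨h1, h2⟩
    simpa using ⟨p.2, h1, h2⟩
  · rintro x y - - hxy
    exact (Prod.ext_iff.1 hxy).2
  · rintro ⟨q, x⟩ hz
    simp only [Finset.coe_filter, Set.Finite.mem_toFinset, Set.mem_ofPred_eq] at hz
    obtain ⟨⟨h1, h2, h3⟩, rfl⟩ := hz
    exact ⟨x, ⟨h2, h3⟩, rfl⟩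

namespace IsLottery

variable {n m f : ℕ} {Tx : Type} {S : System n m f Tx} {Ω : Type*} [MeasurableSpace Ω]
  {μ : Measure Ω} {wins : Ω → Fin n → Set ℝ} {lam : ℝ}

theorem hasLaw_increment [IsProbabilityMeasure μ] (hL : IsLottery S wins lam μ) (hlam : 0 ≤ lam)
    {P : Finset (Fin n)} (hP : P ⊆ S.proposers) {c : ℝ} (hc : (P.card : ℝ) = c * (2 * m + 1)) {s s' : ℝ≥0}
    (h : s ≤ s') :
    HasLaw (fun ω => increment (wins ω) P s s')
      (poissonMeasure (Real.toNNReal (c * lam * ((s' : ℝ) - s)))) μ := by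
  have hs : (0 : ℝ) ≤ s' - s := sub_nonneg.2 (by exact_mod_cast h)
  have hind : iIndepFun (fun (p : P) ω => count (wins ω p) s' - count (wins ω p) s) μ := by
    have h1 := hL.indep.precomp (g := fun p : P => (⟨p.1, hP p.2⟩ : {p // p ∈ S.proposers}))
      (fun a b hab => Subtype.ext (Subtype.mk.inj hab))
    exact h1.comp (fun _ (y : ℝ≥0 → ℕ) => y s' - y s) (fun _ => by fun_prop)
  have h2 := hasLaw_sum_poisson (fun p : P => (hL.poisson p (hP p.2)).law_increments s s' h) hind
    Finset.univ
  have e : ∑ _p : P, Real.toNNReal (lam / (2 * m + 1) * ((s' : ℝ) - s)) =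
      Real.toNNReal (c * lam * ((s' : ℝ) - s)) := by
    have hm : (0 : ℝ) < 2 * m + 1 := by positivity
    have hr : 0 ≤ lam / (2 * m + 1) * ((s' : ℝ) - s) := by positivity
    have hval : (P.card : ℝ) * (lam / (2 * m + 1) * ((s' : ℝ) - s)) = c * lam * (s' - s) := by
      rw [hc]; field_simp
    rw [Finset.sum_const, Finset.card_univ, Fintype.card_coe, ← hval,
      Real.toNNReal_mul (Nat.cast_nonneg _), Real.toNNReal_natCast, nsmul_eq_mul]
  rw [e] at h2
  exact h2

theorem iIndepFun_increment (hL : IsLottery S wins lam μ) {P : Finset (Fin n)}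
    (hP : P ⊆ S.proposers) {t : ℕ → ℝ≥0} (ht : Monotone t) :
    iIndepFun (fun j ω => increment (wins ω) P (t j) (t (j + 1))) μ := by
  refine iIndepFun_sum_of_indep
    (X := fun (p : P) j ω => count (wins ω p) (t (j + 1)) - count (wins ω p) (t j)) ?_ ?_ ?_
  · exact fun p j => ((hL.poisson p (hP p.2)).law_increments _ _ (ht j.le_succ)).aemeasurable
  · have h1 := hL.indep.precomp (g := fun p : P => (⟨p.1, hP p.2⟩ : {p // p ∈ S.proposers}))
      (fun a b hab => Subtype.ext (Subtype.mk.inj hab))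
    exact h1.comp (fun _ (y : ℝ≥0 → ℕ) j => y (t (j + 1)) - y (t j)) (fun _ => by fun_prop)
  · exact fun p => (hL.poisson p (hP p.2)).indepIncrements.nat ht

end IsLottery

/-- Exactly one block proof is found in the window of length `d + e + d` that starts at the time
`w`, and this happens in the middle part, of length `e`. -/
def Isolated {n : ℕ} (W : Fin n → Set ℝ) (P : Finset (Fin n)) (d e w : ℝ≥0) : Prop :=
  increment W P w (w + d) = 0 ∧ increment W P (w + d) (w + d + e) = 1 ∧
    increment W P (w + d + e) (w + (d + e + d)) = 0

/-- The proof `τ` lies in the middle part, so `[τ - d, τ + d]` stays inside the window, where `τ` is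
the only proof. -/
theorem Isolated.exists_unique {n : ℕ} {W : Fin n → Set ℝ} {P : Finset (Fin n)} {d e w : ℝ≥0}
    (h : Isolated W P d e w) (hW : ∀ p ∈ P, ∀ s : ℝ, (W p ∩ Set.Ioc 0 s).Finite) :
    ∃ p ∈ P, ∃ τ ∈ W p, (w + d : ℝ) < τ ∧ τ ≤ w + d + e ∧
      ∀ q ∈ P, ∀ σ ∈ W q, (q, σ) ≠ (p, τ) → σ < τ - d ∨ τ + d < σ := by
  obtain ⟨h1, h2, h3⟩ := h
  rw [increment_eq_ncard le_self_add fun p hp => hW p hp _] at h2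
  rw [increment_eq_ncard le_self_add fun p hp => hW p hp _, Set.ncard_eq_zero
    (proofs_finite (NNReal.coe_nonneg _) fun p hp => hW p hp _)] at h1
  rw [increment_eq_ncard (by rw [← add_assoc, ← add_assoc]; exact le_self_add)
    fun p hp => hW p hp _, Set.ncard_eq_zero
    (proofs_finite (NNReal.coe_nonneg _) fun p hp => hW p hp _)] at h3
  obtain ⟨⟨p, τ⟩, hz⟩ := Set.ncard_eq_one.1 h2
  have hmem : (p, τ) ∈ proofs W P ((w + d : ℝ≥0) : ℝ) ((w + d + e : ℝ≥0) : ℝ) := by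
    rw [hz]; rfl
  obtain ⟨hp, hτ, hlo, hhi⟩ := hmem
  push_cast at hlo hhi h1 h3 hz
  refine ⟨p, hp, τ, hτ, hlo, hhi, fun q hq σ hσ hne => ?_⟩
  by_contra! hcon
  have hA : (w : ℝ) < σ := by linarith
  have hB : σ ≤ w + (d + e + d) := by linarith
  rcases le_or_gt σ (w + d) with h4 | h4
  · exact (h1.subset (show (q, σ) ∈ _ from ⟨hq, hσ, hA, h4⟩)).elim
  · rcases le_or_gt σ (w + d + e) with h5 | h5
    · exact hne (hz.subset (show (q, σ) ∈ _ from ⟨hq, hσ, h4, h5⟩))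
    · exact (h3.subset (show (q, σ) ∈ _ from ⟨hq, hσ, h5, hB⟩)).elim

/-- The end points of the parts of consecutive windows. -/
noncomputable def windowTime (b d e : ℝ≥0) (j : ℕ) : ℝ≥0 :=
  b + (j / 3 : ℕ) * (d + e + d) + if j % 3 = 0 then 0 else if j % 3 = 1 then d else d + e

theorem windowTime_zero (b d e : ℝ≥0) (i : ℕ) :
    windowTime b d e (3 * i) = b + i * (d + e + d) := by
  simp [windowTime]

theorem windowTime_one (b d e : ℝ≥0) (i : ℕ) :
    windowTime b d e (3 * i + 1) = b + i * (d + e + d) + d := by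
  rw [windowTime, show (3 * i + 1) / 3 = i by omega, show (3 * i + 1) % 3 = 1 by omega]
  simp

theorem windowTime_two (b d e : ℝ≥0) (i : ℕ) :
    windowTime b d e (3 * i + 2) = b + i * (d + e + d) + d + e := by
  rw [windowTime, show (3 * i + 2) / 3 = i by omega, show (3 * i + 2) % 3 = 2 by omega]
  simp [add_assoc]

theorem windowTime_three (b d e : ℝ≥0) (i : ℕ) :
    windowTime b d e (3 * i + 2 + 1) = b + i * (d + e + d) + (d + e + d) := by
  rw [show 3 * i + 2 + 1 = 3 * (i + 1) by ring, windowTime_zero]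
  push_cast
  ring

theorem monotone_windowTime (b d e : ℝ≥0) : Monotone (windowTime b d e) := by
  refine monotone_nat_of_le_succ fun j => ?_
  obtain ⟨i, rfl | rfl | rfl⟩ : ∃ i, j = 3 * i ∨ j = 3 * i + 1 ∨ j = 3 * i + 2 :=
    ⟨j / 3, by omega⟩
  · rw [windowTime_zero, windowTime_one]; exact le_self_add
  · rw [windowTime_one, show 3 * i + 1 + 1 = 3 * i + 2 from rfl, windowTime_two]
    exact le_self_add
  · rw [windowTime_two, windowTime_three, ← add_assoc, ← add_assoc]
    exact le_self_add

namespace IsLottery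

variable {n m f : ℕ} {Tx : Type} {S : System n m f Tx} {Ω : Type*} [MeasurableSpace Ω]
  {μ : Measure Ω} [IsProbabilityMeasure μ] {wins : Ω → Fin n → Set ℝ} {lam : ℝ}

-- The windows are disjoint, so their indicators are independent functions of triples of increments.
-- Each has mean `P(0) P(1) P(0)` for Poisson increments over lengths `d`, `e`, `d`, and Hoeffding's
-- bound applies.
open Classical in
theorem isolated_lower_tail (hL : IsLottery S wins lam μ) (hlam : 0 ≤ lam) {P : Finset (Fin n)}
    (hP : P ⊆ S.proposers) {c : ℝ} (hc0 : 0 ≤ c) (hc : (P.card : ℝ) = c * (2 * m + 1))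
    (b d e : ℝ≥0) {κ : ℝ} (hκ : 0 ≤ κ) (k : ℕ) :
    μ.real {ω | ∑ i ∈ Finset.range k,
        (if Isolated (wins ω) P d e (b + i * (d + e + d)) then (1 : ℝ) else 0) ≤
          k * (c * lam * e * Real.exp (-(c * lam) * (d + e + d)) - κ)} ≤
      Real.exp (-2 * k * κ ^ 2) := by
  set t := windowTime b d e with ht
  have htm := monotone_windowTime b d e
  set D : ℕ → Ω → ℕ := fun j ω => increment (wins ω) P (t j) (t (j + 1)) with hD
  have hlaw : ∀ j, HasLaw (D j)
      (poissonMeasure (Real.toNNReal (c * lam * ((t (j + 1) : ℝ) - t j)))) μ :=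
    fun j => hL.hasLaw_increment hlam hP hc (htm j.le_succ)
  have hind : iIndepFun D μ := hL.iIndepFun_increment hP htm
  have htri := iIndepFun_triples (fun j => (hlaw j).aemeasurable) hind
  let φ : (Fin 3 → ℕ) → ℝ := fun y => if y 0 = 0 ∧ y 1 = 1 ∧ y 2 = 0 then 1 else 0
  have hφ : Measurable φ := Measurable.of_discrete
  have hX := htri.comp (fun _ => φ) (fun _ => hφ)
  have hXeq : ∀ i ω, (φ ∘ fun ω (k : Fin 3) => D (3 * i + k) ω) ω =
      if Isolated (wins ω) P d e (b + i * (d + e + d)) then (1 : ℝ) else 0 := by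
    intro i ω
    simp only [φ, hD, Function.comp, Isolated, Fin.val_zero, Fin.val_one, Fin.val_two, ht,
      add_zero, windowTime_zero, windowTime_one, windowTime_two, windowTime_three,
      show 3 * i + 1 + 1 = 3 * i + 2 from rfl]
    congr
  have haem : ∀ i, AEMeasurable (φ ∘ fun ω (k : Fin 3) => D (3 * i + k) ω) μ := fun i =>
    hφ.comp_aemeasurable (aemeasurable_pi_iff.2 fun k => (hlaw _).aemeasurable)
  have hmean : ∀ i, ∫ ω, (φ ∘ fun ω (k : Fin 3) => D (3 * i + k) ω) ω ∂μ =
      c * lam * e * Real.exp (-(c * lam) * (d + e + d)) := by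
    intro i
    have hdiff : ∀ j, Real.toNNReal (c * lam * ((t (j + 1) : ℝ) - t j)) =
        c * lam * ((t (j + 1) : ℝ) - t j) := fun j =>
      Real.coe_toNNReal _ (mul_nonneg (mul_nonneg hc0 hlam)
        (sub_nonneg.2 (by exact_mod_cast htm j.le_succ)))
    have hp : ∀ j x, μ.real (D j ⁻¹' {x}) =
        Real.exp (-(c * lam * ((t (j + 1) : ℝ) - t j))) *
          (c * lam * ((t (j + 1) : ℝ) - t j)) ^ x / x.factorial := by
      intro j x
      have := (hlaw j).measureReal_eq (p := fun y => y = x) (measurableSet_singleton x)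
      rw [show D j ⁻¹' {x} = {ω | D j ω = x} from rfl, this,
        show {y : ℕ | y = x} = {x} from rfl, poissonMeasure_real_singleton, hdiff]
    let x : ℕ → ℕ := fun j => if j = 3 * i + 1 then 1 else 0
    have hinter := hind.measure_inter_preimage_eq_mul {3 * i, 3 * i + 1, 3 * i + 2}
      (sets := fun j => {x j}) (fun j _ => measurableSet_singleton _)
    have hset : (⋂ j ∈ ({3 * i, 3 * i + 1, 3 * i + 2} : Finset ℕ), D j ⁻¹' {x j}) =
        {ω | D (3 * i) ω = 0 ∧ D (3 * i + 1) ω = 1 ∧ D (3 * i + 2) ω = 0} := by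
      ext ω
      simp [x]
    have hfun : (φ ∘ fun ω (k : Fin 3) => D (3 * i + k) ω) =
        (⋂ j ∈ ({3 * i, 3 * i + 1, 3 * i + 2} : Finset ℕ), D j ⁻¹' {x j}).indicator 1 := by
      rw [hset]
      funext ω
      simp only [φ, Function.comp, Fin.val_zero, Fin.val_one, Fin.val_two, add_zero,
        Set.indicator, Set.mem_ofPred_eq, Pi.one_apply]
    have hnull : NullMeasurableSet
        (⋂ j ∈ ({3 * i, 3 * i + 1, 3 * i + 2} : Finset ℕ), D j ⁻¹' {x j}) μ :=
      Finset.nullMeasurableSet_biInter _ fun j _ =>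
        (hlaw j).aemeasurable.nullMeasurableSet_preimage (measurableSet_singleton _)
    rw [hfun, integral_indicator₀ hnull]
    simp only [Pi.one_apply, integral_const, smul_eq_mul, mul_one, measureReal_restrict_apply_univ]
    rw [measureReal_def, hinter, ENNReal.toReal_prod,
      Finset.prod_insert (by simp), Finset.prod_insert (by simp), Finset.prod_singleton]
    simp only [← measureReal_def, hp]
    simp only [x, ht, windowTime_zero, windowTime_one, windowTime_two, windowTime_three,
      show 3 * i + 1 + 1 = 3 * i + 2 from rfl]
    simp only [show ¬ (3 * i = 3 * i + 1) by omega, show ¬ (3 * i + 2 = 3 * i + 1) by omega,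
      if_false, if_true, pow_zero, pow_one, Nat.factorial_zero, Nat.factorial_one, Nat.cast_one,
      div_one, mul_one]
    push_cast
    rw [show -(c * lam) * ((d : ℝ) + e + d) = -(c * lam * d) + (-(c * lam * e) + -(c * lam * d)) by
      ring, Real.exp_add, Real.exp_add]
    ring_nf
  have h := hoeffding_lower_tail hX haem (fun i ω => by
    rw [hXeq]; split_ifs <;> simp) hκ hmean k
  simpa only [hXeq] using h

end IsLottery
end LBFT

/-! ### Overlapping windows and the failure probability -/

namespace LBFT

theorem sum_range_mul {M : Type*} [AddCommMonoid M] (F : ℕ → M) (k l : ℕ) :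
    ∑ j ∈ Finset.range (k * l), F j =
      ∑ u ∈ Finset.range l, ∑ i ∈ Finset.range k, F (i * l + u) := by
  induction k with
  | zero => simp
  | succ k ih =>
    rw [Nat.succ_mul, Finset.sum_range_add, ih, ← Finset.sum_add_distrib]
    exact Finset.sum_congr rfl fun u _ => (Finset.sum_range_succ _ _).symm

namespace IsLottery

variable {n m f : ℕ} {Tx : Type} {S : System n m f Tx} {Ω : Type*} [MeasurableSpace Ω]
  {μ : Measure Ω} [IsProbabilityMeasure μ] {wins : Ω → Fin n → Set ℝ} {lam : ℝ}

-- Windows start at every multiple of `e`, so their middle parts tile the line and few isolated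
-- proofs are lost. A window has length `M * e`, so indices congruent mod `M` give disjoint windows.
-- If the total is small, some residue class `u` has a small sum; a union bound costs the factor
-- `M`.
open Classical in
theorem isolated_grid_lower_tail (hL : IsLottery S wins lam μ) (hlam : 0 ≤ lam)
    {P : Finset (Fin n)} (hP : P ⊆ S.proposers) {c : ℝ} (hc0 : 0 ≤ c)
    (hc : (P.card : ℝ) = c * (2 * m + 1)) (a d e : ℝ≥0) {M : ℕ} (hM0 : 0 < M)
    (hM : d + e + d = M * e) {κ : ℝ} (hκ : 0 ≤ κ) (k : ℕ) :
    μ.real {ω | (((Finset.range (k * M)).filter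
        fun j : ℕ => Isolated (wins ω) P d e (a + j * e)).card : ℝ) ≤
          k * M * (c * lam * e * Real.exp (-(c * lam) * (d + e + d)) - κ)} ≤
      M * Real.exp (-2 * k * κ ^ 2) := by
  set q := c * lam * e * Real.exp (-(c * lam) * (d + e + d)) with hq
  let E : ℕ → Set Ω := fun u => {ω | ∑ i ∈ Finset.range k,
    (if Isolated (wins ω) P d e (a + u * e + i * (d + e + d)) then (1 : ℝ) else 0) ≤ k * (q - κ)}
  have hE : ∀ u, μ.real (E u) ≤ Real.exp (-2 * k * κ ^ 2) := fun u =>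
    hL.isolated_lower_tail hlam hP hc0 hc (a + u * e) d e hκ k
  have hsub : {ω | (((Finset.range (k * M)).filter
        fun j : ℕ => Isolated (wins ω) P d e (a + j * e)).card : ℝ) ≤ k * M * (q - κ)} ⊆
      ⋃ u ∈ Finset.range M, E u := by
    intro ω hω
    by_contra hcon
    simp only [Set.mem_iUnion, not_exists, E, Set.mem_ofPred_eq, not_le] at hcon
    rw [Set.mem_ofPred_eq, Finset.card_filter] at hω
    push_cast at hω
    rw [sum_range_mul] at hω
    have hlt : ∑ u ∈ Finset.range M, (k * (q - κ) : ℝ) < _ :=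
      Finset.sum_lt_sum_of_nonempty (Finset.nonempty_range_iff.2 hM0.ne') hcon
    rw [Finset.sum_const, Finset.card_range, nsmul_eq_mul] at hlt
    refine absurd (hlt.trans_le (le_of_eq ?_)) (not_lt.2 (hω.trans (le_of_eq (by ring))))
    refine Finset.sum_congr rfl fun u _ => Finset.sum_congr rfl fun i _ => ?_
    rw [hM, show a + (u : ℝ≥0) * e + i * (M * e) = a + ((i * M + u : ℕ) : ℝ≥0) * e by
      push_cast; ring]
  calc _ ≤ μ.real (⋃ u ∈ Finset.range M, E u) := measureReal_mono hsub (measure_ne_top _ _)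
    _ ≤ ∑ u ∈ Finset.range M, μ.real (E u) := measureReal_biUnion_finset_le _ _
    _ ≤ ∑ u ∈ Finset.range M, Real.exp (-2 * k * κ ^ 2) := Finset.sum_le_sum fun u _ => hE u
    _ = _ := by simp

theorem measure_not_committed_le (hL : IsLottery S wins lam μ) (hlam : 0 ≤ lam) {Δ gst β : ℝ}
    (hΔ : 0 < Δ) (hβ0 : 0 ≤ β) (hβ1 : β ≤ 1)
    (hβ : ((S.byz ∩ S.proposers).card : ℝ) = β * (2 * m + 1)) (hgst : 0 ≤ gst)
    {mined : Ω → Fin n → ℝ → Block n Tx} {log : Ω → Fin n → ℝ → List (Msg n Tx)}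
    (hE : ∀ᵐ ω ∂μ, IsExecution S Δ gst (wins ω) (mined ω) (log ω)) {t₀ t : ℝ} (ht₀ : gst ≤ t₀)
    (d e : ℝ≥0) (hd : (d : ℝ) = 2 * Δ) {M : ℕ} (hM0 : 0 < M) (hM : d + e + d = M * e)
    {κ s x : ℝ} (hκ : 0 ≤ κ) (hs : 0 ≤ s) {k : ℕ}
    (hk : 2 * Δ + k * (d + e + d : ℝ) + (d + e + d) ≤ t)
    (hx : x + 2 ≤ k * M *
      ((1 - β) * lam * e * Real.exp (-((1 - β) * lam) * (d + e + d)) - κ)) :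
    μ {ω | ¬ ∃ p ∈ S.proposers, p ∉ S.byz ∧ ∃ τ ∈ wins ω p, t₀ < τ ∧ τ ≤ t₀ + t ∧
        ∀ h ∉ S.byz, mined ω p τ ∈ S.mainChain (log ω h (t₀ + t))} ≤
      ENNReal.ofReal (M * Real.exp (-2 * k * κ ^ 2) +
        Real.exp (-s * x + β * lam * t * (Real.exp s - 1))) := by
  classical
  have hd0 : (0 : ℝ) ≤ d := d.coe_nonneg
  have he0 : (0 : ℝ) ≤ e := e.coe_nonneg
  have ht₀0 : 0 ≤ t₀ := hgst.trans ht₀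
  have ht0 : 0 ≤ t := le_trans (by positivity) hk
  set q := (1 - β) * lam * e * Real.exp (-((1 - β) * lam) * (d + e + d)) with hq
  -- Starting `2Δ` after `t₀` secures the margin that `exists_committed` requires.
  let a : ℝ≥0 := ⟨t₀ + 2 * Δ, by positivity⟩
  let u : ℝ≥0 := ⟨t₀, ht₀0⟩
  let u' : ℝ≥0 := ⟨t₀ + t, by positivity⟩
  have huu' : u ≤ u' := by
    rw [← NNReal.coe_le_coe]
    change t₀ ≤ t₀ + t
    linarith
  let H := S.proposers \ S.byz
  let B := S.byz ∩ S.proposers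
  have hHsub : H ⊆ S.proposers := Finset.sdiff_subset
  have hBsub : B ⊆ S.proposers := Finset.inter_subset_right
  have hHcard : (H.card : ℝ) = (1 - β) * (2 * m + 1) := by
    have h := Finset.card_sdiff_add_card_inter S.proposers S.byz
    rw [Finset.inter_comm, S.card_proposers] at h
    have h' : (H.card : ℝ) + ((S.byz ∩ S.proposers).card : ℝ) = 2 * m + 1 := by exact_mod_cast h
    rw [hβ] at h'
    linarith
  let E1 : Set Ω := {ω | (((Finset.range (k * M)).filter
        fun j : ℕ => Isolated (wins ω) H d e (a + j * e)).card : ℝ) ≤ k * M * (q - κ)}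
  let E2 : Set Ω := {ω | x ≤ (increment (wins ω) B u u' : ℕ)}
  let E3 : Set Ω := {ω | ¬ IsExecution S Δ gst (wins ω) (mined ω) (log ω)}
  have h1 : μ.real E1 ≤ M * Real.exp (-2 * k * κ ^ 2) :=
    hL.isolated_grid_lower_tail hlam hHsub (by linarith) hHcard a d e hM0 hM hκ k
  have h2 : μ.real E2 ≤ Real.exp (-s * x + β * lam * t * (Real.exp s - 1)) := by
    have h := poisson_tail_le (hL.hasLaw_increment hlam hBsub hβ huu') hs x
    rw [show (u' : ℝ) - u = t by change t₀ + t - t₀ = t; ring,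
      Real.coe_toNNReal _ (by positivity)] at h
    exact h
  have h3 : μ E3 = 0 := hE
  have hsub : {ω | ¬ ∃ p ∈ S.proposers, p ∉ S.byz ∧ ∃ τ ∈ wins ω p, t₀ < τ ∧ τ ≤ t₀ + t ∧
        ∀ h ∉ S.byz, mined ω p τ ∈ S.mainChain (log ω h (t₀ + t))} ⊆ E1 ∪ E2 ∪ E3 := by
    intro ω hω
    by_contra hcon
    simp only [Set.mem_union, not_or] at hcon
    obtain ⟨⟨hn1, hn2⟩, hn3⟩ := hcon
    simp only [E1, Set.mem_ofPred_eq, not_le] at hn1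
    simp only [E2, Set.mem_ofPred_eq, not_le] at hn2
    simp only [E3, Set.mem_ofPred_eq, not_not] at hn3
    refine hω ?_
    set G := (Finset.range (k * M)).filter
      fun j : ℕ => Isolated (wins ω) H d e (a + j * e) with hG
    have hfin : ∀ p ∈ S.proposers, ∀ s : ℝ, (wins ω p ∩ Set.Ioc 0 s).Finite := fun p hp s =>
      (hL.poisson p hp).locallyFinite ω s
    have hiso : ∀ j ∈ G, ∃ p ∈ H, ∃ τ ∈ wins ω p, (a + j * e + d : ℝ) < τ ∧
        τ ≤ a + j * e + d + e ∧ ∀ q ∈ H, ∀ σ ∈ wins ω q, (q, σ) ≠ (p, τ) →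
          σ < τ - d ∨ τ + d < σ := by
      intro j hj
      have := ((Finset.mem_filter.1 hj).2).exists_unique fun p hp => hfin p (hHsub hp)
      push_cast at this
      exact this
    have hiso' : ∀ j, ∃ z : Fin n × ℝ, j ∈ G → z.1 ∈ H ∧ z.2 ∈ wins ω z.1 ∧
        (a + j * e + d : ℝ) < z.2 ∧ z.2 ≤ a + j * e + d + e ∧
        ∀ q ∈ H, ∀ σ ∈ wins ω q, (q, σ) ≠ z → σ < z.2 - d ∨ z.2 + d < σ := by
      intro j
      by_cases hj : j ∈ G
      · obtain ⟨p, hp, τ, hτ, h⟩ := hiso j hj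
        exact ⟨(p, τ), fun _ => ⟨hp, hτ, h⟩⟩
      · obtain ⟨p, hp⟩ : S.proposers.Nonempty :=
          Finset.card_pos.1 (by rw [S.card_proposers]; omega)
        exact ⟨(p, 0), fun h => (hj h).elim⟩
    choose z hz using hiso'
    have ha : (a : ℝ) = t₀ + 2 * Δ := rfl
    have hfinB := proofs_finite (W := wins ω) (P := B) (s := t₀) (s' := t₀ + t) ht₀0
      fun p hp => hfin p (hBsub hp) _
    have hMe : (d + e + d : ℝ) = M * e := by exact_mod_cast hM
    have hcardB : hfinB.toFinset.card = increment (wins ω) B u u' := by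
      rw [increment_eq_ncard huu' fun p hp => hfin p (hBsub hp) _, ← Set.ncard_eq_toFinset_card _ hfinB]
      rfl
    refine hn3.exists_committed hΔ ht₀ G (fun j => (z j).1) (fun j => (z j).2)
      (fun j hj => hHsub (hz j hj).1) (fun j hj => (Finset.mem_sdiff.1 (hz j hj).1).2)
      (fun j hj => (hz j hj).2.1) ?_ ?_ ?_ ?_ hfinB.toFinset ?_ ?_
    · intro j hj q hq hqb σ hσ hne
      rw [← hd]
      exact (hz j hj).2.2.2.2 q (Finset.mem_sdiff.2 ⟨hq, hqb⟩) σ hσ hne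
    -- The middle parts for `i < j` are disjoint half-open intervals in order, so distinct indices
    -- give distinct proofs.
    · intro i hi j hj hij
      have hi' := (hz i hi).2.2.2.1
      have hj' := (hz j hj).2.2.1
      have hij' : (i : ℝ) + 1 ≤ j := by exact_mod_cast hij
      have := mul_le_mul_of_nonneg_right hij' he0
      change (z i).2 < (z j).2
      linarith
    · intro j hj
      have hj' := (hz j hj).2.2.1
      have : (0 : ℝ) ≤ j * e := by positivity
      change _ < (z j).2
      linarith
    · intro j hj
      have hj' := (hz j hj).2.2.2.1
      have hjlt : j + 1 ≤ k * M := Finset.mem_range.1 (Finset.mem_filter.1 hj).1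
      have hjlt' : (j : ℝ) + 1 ≤ k * M := by exact_mod_cast hjlt
      have := mul_le_mul_of_nonneg_right hjlt' he0
      rw [mul_assoc, ← hMe] at this
      change (z j).2 + _ ≤ _
      linarith
    · intro q hq hqb σ hσ h1 h2
      rw [Set.Finite.mem_toFinset]
      exact ⟨Finset.mem_inter.2 ⟨hqb, hq⟩, hσ, h1, h2⟩
    · rw [hcardB]
      have : ((increment (wins ω) B u u' : ℕ) : ℝ) + 2 < G.card := by linarith
      exact_mod_cast this
  calc _ ≤ μ (E1 ∪ E2 ∪ E3) := measure_mono hsub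
    _ ≤ μ (E1 ∪ E2) + μ E3 := measure_union_le _ _
    _ ≤ μ E1 + μ E2 + 0 := by rw [h3]; gcongr; exact measure_union_le _ _
    _ = ENNReal.ofReal (μ.real E1 + μ.real E2) := by
      rw [add_zero, ENNReal.ofReal_add measureReal_nonneg measureReal_nonneg,
        ofReal_measureReal, ofReal_measureReal]
    _ ≤ _ := ENNReal.ofReal_le_ofReal (add_le_add h1 h2)

end IsLottery
end LBFT

/-! ### Choice of the constants -/

namespace LBFT

/-- A middle part of length `2Δ / K` lowers the detected rate; the loss vanishes as `K → ∞`, so the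
strict inequality survives for some `K`. -/
theorem exists_grid {R B Δ : ℝ} (h : B < R * Real.exp (-R * (4 * Δ))) :
    ∃ K : ℕ, 0 < K ∧ B < R * Real.exp (-R * (4 * Δ + 2 * Δ / K)) := by
  have h1 : Filter.Tendsto (fun K : ℕ => R * Real.exp (-R * (4 * Δ + 2 * Δ / K)))
      Filter.atTop (nhds (R * Real.exp (-R * (4 * Δ + 0)))) := by
    have := tendsto_const_div_atTop_nhds_zero_nat (2 * Δ)
    exact ((Real.continuous_exp.tendsto _).comp ((this.const_add _).const_mul _)).const_mul _
  rw [add_zero] at h1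
  obtain ⟨K, hK, hK0⟩ := ((h1.eventually_const_lt h).and (Filter.eventually_gt_atTop 0)).exists
  exact ⟨K, hK0, hK⟩

/-- For `0 < s ≤ 1`, `exp s - 1 ≤ s + s²`, and `s ≤ g / (B + 1)` gives `B * s ≤ g`. -/
theorem exists_chernoff_parameter {B g : ℝ} (hB : 0 ≤ B) (hg : 0 < g) :
    ∃ s > 0, B * (Real.exp s - 1) ≤ s * (B + g) := by
  refine ⟨min 1 (g / (B + 1)), by positivity, ?_⟩
  set s := min 1 (g / (B + 1)) with hs
  have hs0 : 0 < s := by positivity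
  have h1 : |s| ≤ 1 := by rw [abs_of_pos hs0]; exact min_le_left _ _
  have h2 := (abs_le.1 (Real.abs_exp_sub_one_sub_id_le h1)).2
  have h3 : s * (B + 1) ≤ g := (le_div_iff₀ (by positivity)).1 (min_le_right _ _)
  have h4 : B * s ≤ g := by nlinarith
  calc B * (Real.exp s - 1) ≤ B * (s + s ^ 2) := by
        apply mul_le_mul_of_nonneg_left _ hB; linarith
    _ = s * (B + B * s) := by ring
    _ ≤ s * (B + g) := by gcongr

end LBFT

theorem mainTheorem2 (lam Δ β δ η : ℝ) (hlam : 0 < lam) (hΔ : 0 < Δ) (hβ : 0 ≤ β) (hδ : 0 < δ)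
    (hη : η = Real.exp (-2 * (1 - β) * lam * Δ)) (hcond : η ^ 2 * (1 - β) > (1 + δ) * β) :
    ∃ c > 0, ∃ T : ℝ, ∀ (n m f : ℕ) (Tx : Type) (S : LBFT.System n m f Tx),
      ((S.byz ∩ S.proposers).card : ℝ) = β * (2 * m + 1) →
      ∀ (Ω : Type*) [MeasurableSpace Ω] (μ : Measure Ω) [IsProbabilityMeasure μ]
        (wins : Ω → Fin n → Set ℝ), LBFT.IsLottery S wins lam μ →
      ∀ (gst : ℝ), 0 ≤ gst →
      ∀ (mined : Ω → Fin n → ℝ → LBFT.Block n Tx) (log : Ω → Fin n → ℝ → List (LBFT.Msg n Tx)),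
        (∀ᵐ ω ∂μ, LBFT.IsExecution S Δ gst (wins ω) (mined ω) (log ω)) →
      ∀ t₀ ≥ gst, ∀ t ≥ T,
        μ {ω | ¬ ∃ p ∈ S.proposers, p ∉ S.byz ∧ ∃ τ ∈ wins ω p, t₀ < τ ∧ τ ≤ t₀ + t ∧
            ∀ h ∉ S.byz, mined ω p τ ∈ S.mainChain (log ω h (t₀ + t))}
          ≤ ENNReal.ofReal (Real.exp (-c * t)) := by
  have hβ1 : β < 1 := by
    have h1 : 0 < η ^ 2 * (1 - β) := lt_of_le_of_lt (by positivity) hcond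
    have h2 : 0 ≤ η ^ 2 := sq_nonneg η
    by_contra! h
    nlinarith
  set R := (1 - β) * lam with hR
  have hR0 : 0 < R := mul_pos (by linarith) hlam
  have hB0 : 0 ≤ β * lam := by positivity
  have hη2 : η ^ 2 = Real.exp (-R * (4 * Δ)) := by
    rw [hη, ← Real.exp_nat_mul]
    congr 1
    push_cast
    rw [hR]
    ring
  have hrate : β * lam < R * Real.exp (-R * (4 * Δ)) := by
    rw [← hη2, hR]
    have h1 : β < η ^ 2 * (1 - β) := lt_of_le_of_lt (by nlinarith) hcond
    nlinarith
  obtain ⟨K, hK0, hK⟩ := LBFT.exists_grid hrate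
  have hK0' : (0 : ℝ) < K := by exact_mod_cast hK0
  set e : ℝ := 2 * Δ / K with he
  have he0 : 0 < e := by positivity
  set L : ℝ := 4 * Δ + e with hL
  have hL0 : 0 < L := by positivity
  set A : ℝ := R * Real.exp (-R * L) with hA
  set g : ℝ := A - β * lam with hg
  have hg0 : 0 < g := by linarith
  have hA0 : 0 < A := by positivity
  obtain ⟨s, hs0, hs⟩ := LBFT.exists_chernoff_parameter hB0 (show 0 < g / 8 by positivity)
  -- The gap `g` is split: Hoeffding may lose `g / 4` of the rate, the Byzantine threshold is `βλ +
  -- g / 4`, and the remaining `g / 2` absorbs boundary effects. Chernoff's parameter is chosen for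
  -- an excess of `g / 8`, leaving `g / 8` as decay.
  set κ : ℝ := e * (g / 4) with hκ
  have hκ0 : 0 < κ := by positivity
  set M : ℕ := 2 * K + 1 with hM
  have hMe : (M : ℝ) * e = L := by
    rw [hM, hL, he]
    push_cast
    field_simp
    ring
  set c : ℝ := min (κ ^ 2 / L) (s * (g / 8)) / 2 with hc
  have hc0 : 0 < c := by positivity
  -- The three thresholds: the spare `t * g / 2` covers the boundary loss and the 2 discarded
  -- blocks; `k * L ≥ t / 2`; and `exp (c * t)` absorbs the prefactor `M + 1`, since both tails are
  -- at most `exp (-2ct)`.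
  refine ⟨c, hc0, max (max (2 * ((2 * Δ + 2 * L) * A + 2) / g) (2 * (2 * Δ + 2 * L)))
    (Real.log (M + 1) / c), ?_⟩
  intro n m f Tx S hβ' Ω _ μ _ wins hlot gst hgst mined log hE t₀ ht₀ t ht
  have ht1 : 2 * ((2 * Δ + 2 * L) * A + 2) / g ≤ t :=
    (le_max_left _ _).trans ((le_max_left _ _).trans ht)
  have ht2 : 2 * (2 * Δ + 2 * L) ≤ t := (le_max_right _ _).trans ((le_max_left _ _).trans ht)
  have ht3 : Real.log (M + 1) / c ≤ t := (le_max_right _ _).trans ht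
  have ht0 : 0 < t := lt_of_lt_of_le (by positivity) ht2
  rw [div_le_iff₀ hg0] at ht1
  rw [div_le_iff₀ hc0] at ht3
  set k : ℕ := ⌊(t - 2 * Δ - L) / L⌋₊ with hk
  have hk1 : k * L ≤ t - 2 * Δ - L := by
    rw [← le_div_iff₀ hL0]
    exact Nat.floor_le (div_nonneg (by linarith) hL0.le)
  have hk2 : t - 2 * Δ - 2 * L < k * L := by
    have h1 := Nat.lt_floor_add_one ((t - 2 * Δ - L) / L)
    rw [div_lt_iff₀ hL0] at h1
    linarith
  have h2d : (0 : ℝ) ≤ 2 * Δ := by positivity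
  have hLsum : (2 * Δ + e + 2 * Δ) = L := by rw [hL]; ring
  have hx : (β * lam + g / 4) * t + 2 ≤
      k * M * ((1 - β) * lam * e * Real.exp (-((1 - β) * lam) * (2 * Δ + e + 2 * Δ)) - κ) := by
    rw [hLsum, ← hR, show k * M * (R * e * Real.exp (-R * L) - κ) =
      (k * (M * e)) * (A - g / 4) by rw [hκ, hA]; ring, hMe]
    have h1 : 0 < A - g / 4 := by linarith
    have h2 := mul_le_mul_of_nonneg_right hk2.le h1.le
    have h3 : (2 * Δ + 2 * L) * (A - g / 4) ≤ (2 * Δ + 2 * L) * A :=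
      mul_le_mul_of_nonneg_left (by linarith) (by positivity)
    have h4 : A - g / 4 = β * lam + g / 4 + g / 2 := by rw [hg]; ring
    have h5 : t * (A - g / 4) = (β * lam + g / 4) * t + t * g / 2 := by rw [h4]; ring
    linarith
  have key := hlot.measure_not_committed_le hlam.le hΔ hβ hβ1.le hβ' hgst hE ht₀
    ⟨2 * Δ, h2d⟩ ⟨e, he0.le⟩ rfl (M := M) (by omega)
    (by
      rw [← NNReal.coe_inj]
      change 2 * Δ + e + 2 * Δ = M * e
      rw [hMe, hLsum])
    hκ0.le hs0.le (k := k) (x := (β * lam + g / 4) * t)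
    (by
      change 2 * Δ + k * (2 * Δ + e + 2 * Δ) + (2 * Δ + e + 2 * Δ) ≤ t
      rw [hLsum]
      linarith) hx
  refine key.trans (ENNReal.ofReal_le_ofReal ?_)
  have hc1 : 2 * c ≤ κ ^ 2 / L := by
    rw [hc]; linarith [min_le_left (κ ^ 2 / L) (s * (g / 8))]
  have hc2 : 2 * c ≤ s * (g / 8) := by
    rw [hc]; linarith [min_le_right (κ ^ 2 / L) (s * (g / 8))]
  have e1 : -2 * k * κ ^ 2 ≤ -(2 * c * t) := by
    have h1 : 2 * c * t ≤ κ ^ 2 / L * t := mul_le_mul_of_nonneg_right hc1 ht0.le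
    have h2 : κ ^ 2 / L * t ≤ κ ^ 2 / L * (2 * (k * L)) :=
      mul_le_mul_of_nonneg_left (by linarith) (by positivity)
    have h3 : κ ^ 2 / L * (2 * (k * L)) = 2 * k * κ ^ 2 := by field_simp
    linarith
  have e2 : -s * ((β * lam + g / 4) * t) + β * lam * t * (Real.exp s - 1) ≤ -(2 * c * t) := by
    have h1 := mul_le_mul_of_nonneg_right hs ht0.le
    have h2 := mul_le_mul_of_nonneg_right hc2 ht0.le
    linarith
  have e3 : (M : ℝ) + 1 ≤ Real.exp (c * t) := by
    rw [← Real.log_le_iff_le_exp (by positivity)]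
    linarith
  calc M * Real.exp (-2 * k * κ ^ 2) +
        Real.exp (-s * ((β * lam + g / 4) * t) + β * lam * t * (Real.exp s - 1))
      ≤ M * Real.exp (-(2 * c * t)) + Real.exp (-(2 * c * t)) := by gcongr
    _ = (M + 1) * Real.exp (-(2 * c * t)) := by ring
    _ ≤ Real.exp (c * t) * Real.exp (-(2 * c * t)) := by gcongr
    _ = Real.exp (-c * t) := by
      rw [← Real.exp_add]
      ring_nf
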